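/- Let $N\ge 1$ and $S$ be natural numbers and, for $i=1,\dots,N$, let $X_i\subseteq\mathbb R^{n_i}$ be nonempty, compact and convex, let $f_i:\mathbb R^{n_i}\to\mathbb R$ be convex, and let $\mathbf g_i:\mathbb R^{n_i}\to\mathbb R^S$ be component-wise convex. Consider the constraint-coupled problem $$\min_{x_1,\dots,x_N}\ \sum_{i=1}^N f_i(x_i)\quad\text{subject to}\quad x_i\in X_i\ (i=1,\dots,N),\quad \sum_{i=1}^N \mathbf g_i(x_i)\preceq \mathbf 0, \tag{P}$$ and assume Slater's condition: there are points $\bar x_i$ in the relative interior of $X_i$ with $\sum_{i=1}^N\mathbf g_i(\bar x_i)\prec\mathbf 0$. Let $\mu^\star$ be an optimal solution of the dual problem of (P), $$\max_{\mu\in\mathbb R^S,\ \mu\succeq \mathbf 0}\ \inf_{x_1\in X_1,\dots,x_N\in X_N}\ \sum_{i=1}^N\big(f_i(x_i)+\mu^\top\mathbf g_i(x_i)\big),$$ and let $M>\|\mu^\star\|_1$. Let $\mathcal G$ be a connected undirected graph with vertex set $\{1,\dots,N\}$, let $\mathcal N_i$ be the set of neighbors of $i$, and let $(\gamma^t)_{t\ge0}$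 be nonnegative step sizes with $\sum_{t}\gamma^t=\infty$ and $\sum_t(\gamma^t)^2<\infty$. Let $x_i^t\in\mathbb R^{n_i}$, $\rho_i^t\in\mathbb R$, $\mu_i^t\in\mathbb R^S$ and $\lambda_{ij}^t\in\mathbb R^S$ ($j\in\mathcal N_i$), $t\ge 0$, be generated, from arbitrary initial values, by the following algorithm. For every $t\ge0$ and every $i$, $\big((x_i^{t+1},\rho_i^{t+1}),\mu_i^{t+1}\big)$ is a primal-dual optimal solution pair of $$\min_{x_i,\rho_i}\ f_i(x_i)+M\rho_i\quad\text{subject to}\quad \rho_i\ge0,\quad x_i\in X_i,\quad \mathbf g_i(x_i)+\sum_{j\in\mathcal N_i}(\lambda_{ij}^t-\lambda_{ji}^t)\preceq\rho_i\mathbf 1,$$ where $\mu_i^{t+1}$ is the multiplier of the last (vector) inequality constraint; that is, $(x_i^{t+1},\rho_i^{t+1})$ is an optimal solution of this problem, and $\mu_i^{t+1}$ is an optimal solution of its Lagrangian dual in which only that constraint is dualized. Then, for every $i$ and $j\in\mathcal N_i$, $$\lambda_{ij}^{t+1}=\lambda_{ij}^t-\gamma^t\big(\mu_i^{t+1}-\mu_j^{t+1}\big).$$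 Then problem (P) has a finite, attained optimal cost $f^\star$, and: 1. $\sum_{i=1}^N\big(f_i(x_i^t)+M\rho_i^t\big)\to f^\star$ as $t\to\infty$; 2. every limit point of the sequence $\big((x_1^t,\dots,x_N^t)\big)_{t\ge0}$ is an optimal (in particular feasible) solution of (P). -/

import Mathlib

open Filter Topology

/-- The data of a finite-dimensional inequality constrained minimization problem
`min cost z` subject to `z ∈ domain` and `constr z ⪯ 0` (component-wise, `S` scalar constraints).
Membership in `domain` is not dualized. -/
structure ConstrainedProgram (E : Type*) (S : ℕ) where
  /-- the abstract constraint set -/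
  domain : Set E
  /-- the objective function -/
  cost : E → ℝ
  /-- the left-hand side of the constraint `constr z ⪯ 0` -/
  constr : E → Fin S → ℝ

namespace ConstrainedProgram

variable {E : Type*} {S : ℕ}

/-- The feasible set. -/
def feasibleSet (P : ConstrainedProgram E S) : Set E :=
  {z | z ∈ P.domain ∧ ∀ s, P.constr z s ≤ 0}

/-- `z` is a (global) optimal solution; in particular it is feasible. -/
def IsPrimalOptimal (P : ConstrainedProgram E S) (z : E) : Prop :=
  z ∈ P.feasibleSet ∧ ∀ w ∈ P.feasibleSet, P.cost z ≤ P.cost w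

/-- `v` is the optimal cost, attained at some feasible point. -/
def IsOptimalCost (P : ConstrainedProgram E S) (v : ℝ) : Prop :=
  IsLeast (P.cost '' P.feasibleSet) v

/-- The Lagrangian `cost z + μᵀ constr z`. -/
def lagrangian (P : ConstrainedProgram E S) (z : E) (μ : Fin S → ℝ) : ℝ :=
  P.cost z + ∑ s, μ s * P.constr z s

/-- The dual function `q(μ) = inf_{z ∈ domain} (cost z + μᵀ constr z)`, which may be `-∞`. -/
noncomputable def dualFunction (P : ConstrainedProgram E S) (μ : Fin S → ℝ) : EReal :=
  ⨅ z ∈ P.domain, ((P.lagrangian z μ : ℝ) : EReal)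

/-- `μ` is an optimal solution of the dual problem `max q(μ)` subject to `μ ⪰ 0`. -/
def IsDualOptimal (P : ConstrainedProgram E S) (μ : Fin S → ℝ) : Prop :=
  (∀ s, 0 ≤ μ s) ∧
    ∀ ν : Fin S → ℝ, (∀ s, 0 ≤ ν s) → P.dualFunction ν ≤ P.dualFunction μ

/-- `(z, μ)` is a primal-dual optimal solution pair. -/
def IsPrimalDualOptimal (P : ConstrainedProgram E S) (z : E) (μ : Fin S → ℝ) : Prop :=
  P.IsPrimalOptimal z ∧ P.IsDualOptimal μ

end ConstrainedProgram

/-- The constraint-coupled problem: minimize `∑ i, f i (x i)` subject to `x i ∈ X i` for all `i`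
and `∑ i, g i (x i) ⪯ 0`. -/
def coupledProgram {N S : ℕ} {n : Fin N → ℕ}
    (X : ∀ i, Set (EuclideanSpace ℝ (Fin (n i))))
    (f : ∀ i, EuclideanSpace ℝ (Fin (n i)) → ℝ)
    (g : ∀ i, EuclideanSpace ℝ (Fin (n i)) → Fin S → ℝ) :
    ConstrainedProgram (∀ i, EuclideanSpace ℝ (Fin (n i))) S where
  domain := {x | ∀ i, x i ∈ X i}
  cost := fun x => ∑ i, f i (x i)
  constr := fun x s => ∑ i, g i (x i) s

/-- The local relaxed problem in the variables `(x, ρ)`: minimize `f x + M ρ` subject to `ρ ≥ 0`,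
`x ∈ X` and `g x + d ⪯ ρ 1`. -/
def localProgram {m S : ℕ} (X : Set (EuclideanSpace ℝ (Fin m)))
    (f : EuclideanSpace ℝ (Fin m) → ℝ) (g : EuclideanSpace ℝ (Fin m) → Fin S → ℝ)
    (M : ℝ) (d : Fin S → ℝ) :
    ConstrainedProgram (EuclideanSpace ℝ (Fin m) × ℝ) S where
  domain := {z | z.1 ∈ X ∧ 0 ≤ z.2}
  cost := fun z => f z.1 + M * z.2
  constr := fun z s => g z.1 s + d s - z.2

/-- The sequences `x`, `ρ`, `μ`, `lam` are generated by the distributed algorithm over the graph `G`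
with penalty `M` and step sizes `γ`. The values at time `0` are arbitrary, and `lam t i j` is only
used for neighbors `i`, `j`. -/
structure IsGeneratedByAlgorithm {N S : ℕ} {n : Fin N → ℕ}
    (G : SimpleGraph (Fin N)) [DecidableRel G.Adj]
    (X : ∀ i, Set (EuclideanSpace ℝ (Fin (n i))))
    (f : ∀ i, EuclideanSpace ℝ (Fin (n i)) → ℝ)
    (g : ∀ i, EuclideanSpace ℝ (Fin (n i)) → Fin S → ℝ)
    (M : ℝ) (γ : ℕ → ℝ)
    (x : ℕ → ∀ i, EuclideanSpace ℝ (Fin (n i))) (ρ : ℕ → Fin N → ℝ)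
    (μ : ℕ → Fin N → Fin S → ℝ) (lam : ℕ → Fin N → Fin N → Fin S → ℝ) : Prop where
  /-- the local step: node `i` computes a primal-dual optimal solution pair -/
  local_step : ∀ t i,
    (localProgram (X i) (f i) (g i) M
      (∑ j ∈ G.neighborFinset i, (lam t i j - lam t j i))).IsPrimalDualOptimal
        (x (t + 1) i, ρ (t + 1) i) (μ (t + 1) i)
  /-- the linear update of the variables on the edges -/
  update : ∀ t i j, G.Adj i j →
    lam (t + 1) i j = lam t i j - γ t • (μ (t + 1) i - μ (t + 1) j)

/-!
The algorithm is a subgradient method in disguise. Write `d i = G.netFlow lam i` for the quantity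
`∑ j ∈ N i, (lam i j - lam j i)` added to the constraint of node `i`, and `p i (d i)` for the
optimal cost of the local problem. The total cost `∑ i, p i (d i)` is a convex function of the edge
variables, the multipliers `μ i` are subgradients of the `p i`, so `μ i - μ j` is the component of a
subgradient along `lam i j`, and the edge update is a subgradient step. The functions `p i` are
never introduced formally: everything needed about them is an inequality between costs at optimal
solutions.

The value of this edge problem is the optimal cost `fStar` of the coupled problem. It is at most
`fStar` since, on a connected graph, net flows realize every family of vectors with zero sum
(`SimpleGraph.Connected.exists_netFlow_eq`), in particular one that shares the slack of an optimal
solution equally among the nodes. It is at least `fStar` since the net flows sum to zero, so that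
the local solutions satisfy `∑ i, g i (x i) ⪯ (∑ i, ρ i) 1`; by strong duality for the coupled
problem such points cost at least `fStar - ‖muStar‖₁ ∑ i, ρ i`, and the penalty `M` exceeds
`‖muStar‖₁`. The same strict inequality forces the violation at a limit point to vanish, which makes
limit points feasible and optimal.

Strong duality (`ConstrainedProgram.exists_multiplier`) is proved by separating a point from an open
convex set. Applied to the local problem it yields the subgradient inequality and the bound
`∑ s, μ s ≤ M`, because `ρ` is unbounded above. Hence the subgradients are bounded, the squared
distance of the edge variables to an optimal flow is quasi-decreasing
(`SimpleGraph.flowDistSq_step_le`), and the optimality gap `a` satisfies `∑ γ t * a t < ∞`. As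
`a (t + 1) ≤ a t + K * γ t`, the sequence `a t ^ 2` is decreasing up to summable errors, hence
converges, necessarily to zero (`tendsto_zero_of_descent`). Convergence of the edge variables
themselves is not needed.
-/

/-! ### Strong duality -/

namespace ConstrainedProgram

/-- Existence of Lagrange multipliers with zero duality gap under Slater's condition: the set of pairs
`(u, r)` for which some `z` has `constr z < u` and `cost z < r` is open, convex and misses `(0, v)`;
a separating functional, normalized in the cost direction, gives the multipliers. -/
theorem exists_multiplier {E : Type*} [AddCommGroup E] [Module ℝ E] {S : ℕ}
    (P : ConstrainedProgram E S) (hcost : ConvexOn ℝ P.domain P.cost)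
    (hconstr : ∀ s, ConvexOn ℝ P.domain (fun z => P.constr z s))
    {z₀ : E} (hz₀ : z₀ ∈ P.domain) (hstrict : ∀ s, P.constr z₀ s < 0)
    {v : ℝ} (hv : ∀ w ∈ P.feasibleSet, v ≤ P.cost w) :
    ∃ μ : Fin S → ℝ, (∀ s, 0 ≤ μ s) ∧ ∀ z ∈ P.domain, v ≤ P.lagrangian z μ := by
  set A : Set ((Fin S → ℝ) × ℝ) :=
    {p | ∃ z ∈ P.domain, (∀ s, P.constr z s < p.1 s) ∧ P.cost z < p.2} with hA
  have hAconv : Convex ℝ A := by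
    rintro p ⟨z, hz, hz1, hz2⟩ q ⟨w, hw, hw1, hw2⟩ a b ha hb hab
    refine ⟨a • z + b • w, hcost.1 hz hw ha hb hab, fun s => ?_, ?_⟩
    · refine ((hconstr s).2 hz hw ha hb hab).trans_lt ?_
      have h1 := hz1 s
      have h2 := hw1 s
      simp only [smul_eq_mul, Prod.fst_add, Prod.smul_fst, Pi.add_apply, Pi.smul_apply]
      rcases ha.eq_or_lt with rfl | ha
      · have : b = 1 := by linarith
        subst this; linarith
      · nlinarith [mul_lt_mul_of_pos_left h1 ha, mul_le_mul_of_nonneg_left h2.le hb]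
    · refine (hcost.2 hz hw ha hb hab).trans_lt ?_
      simp only [smul_eq_mul, Prod.snd_add, Prod.smul_snd]
      rcases ha.eq_or_lt with rfl | ha
      · have : b = 1 := by linarith
        subst this; linarith
      · nlinarith [mul_lt_mul_of_pos_left hz2 ha, mul_le_mul_of_nonneg_left hw2.le hb]
  have hAopen : IsOpen A := by
    have : A = ⋃ z ∈ P.domain, {p | (∀ s, P.constr z s < p.1 s) ∧ P.cost z < p.2} := by
      ext p; simp [hA, and_left_comm]
    rw [this]
    refine isOpen_biUnion fun z _ => IsOpen.and ?_ (isOpen_lt continuous_const continuous_snd)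
    simp only [Set.ofPred_forall]
    exact isOpen_iInter_of_finite fun s =>
      isOpen_lt continuous_const ((continuous_apply s).comp continuous_fst)
  have hvA : ((0 : Fin S → ℝ), v) ∉ A := by
    rintro ⟨z, hz, h1, h2⟩
    exact (hv z ⟨hz, fun s => (h1 s).le⟩).not_gt h2
  obtain ⟨φ, hφ⟩ := geometric_hahn_banach_open_point hAconv hAopen hvA
  set ν : Fin S → ℝ := fun s => φ (Pi.single s 1, 0) with hν
  set α : ℝ := φ (0, 1) with hα
  have hφeq : ∀ u r, φ (u, r) = ∑ s, u s * ν s + r * α := by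
    intro u r
    have h1 : φ (u, r) = (φ.toLinearMap ∘ₗ LinearMap.inl ℝ _ _) u + φ (r • (0, 1)) := by
      simp [← map_add]
    rw [h1, LinearMap.pi_apply_eq_sum_univ, map_smul]
    simp only [hν, hα, smul_eq_mul, LinearMap.comp_apply, LinearMap.inl_apply]
    congr 1
    refine Finset.sum_congr rfl fun s _ => ?_
    have h2 : (fun j => if s = j then (1 : ℝ) else 0) = Pi.single s 1 := by
      ext j
      simp [Pi.single_apply, eq_comm]
    rw [h2]
    rfl
  have hsep : ∀ z ∈ P.domain, ∀ (u : Fin S → ℝ) (r : ℝ), (∀ s, P.constr z s < u s) → P.cost z < r →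
      ∑ s, u s * ν s + r * α < v * α := by
    intro z hz u r hu hr
    have := hφ (u, r) ⟨z, hz, hu, hr⟩
    simpa [hφeq] using this
  -- `A` is upward closed, so the separating functional is nonpositive in every direction.
  have hνnonpos : ∀ s, ν s ≤ 0 := by
    intro s
    by_contra! hs
    have hbase := hsep z₀ hz₀ (Pi.single s ((|v * α - (P.cost z₀ + 1) * α|) / ν s))
      (P.cost z₀ + 1) (fun s' => by
        refine (hstrict s').trans_le ?_
        rw [Pi.single_apply]; split_ifs <;> positivity) (by linarith)
    simp only [Pi.single_apply, ite_mul, zero_mul, Finset.sum_ite_eq', Finset.mem_univ,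
      if_true] at hbase
    rw [div_mul_cancel₀ _ hs.ne'] at hbase
    linarith [le_abs_self (v * α - (P.cost z₀ + 1) * α)]
  -- The separating hyperplane is not vertical, by Slater's condition.
  have hαneg : α < 0 := by
    by_contra! hα0
    have := hsep z₀ hz₀ 0 (max v (P.cost z₀ + 1)) hstrict
      ((lt_add_one _).trans_le (le_max_right _ _))
    simp only [Pi.zero_apply, zero_mul, Finset.sum_const_zero, zero_add] at this
    linarith [mul_le_mul_of_nonneg_right (le_max_left v (P.cost z₀ + 1)) hα0]
  refine ⟨fun s => ν s / α, fun s => div_nonneg_of_nonpos (hνnonpos s) hαneg.le,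
    fun z hz => ?_⟩
  -- Let `u` and `r` decrease to `constr z` and `cost z`.
  have hle : (P.cost z - v) * α + ∑ s, P.constr z s * ν s ≤ 0 := by
    have hlim : Tendsto (fun ε : ℝ => ∑ s, (P.constr z s + ε) * ν s + (P.cost z + ε) * α)
        (𝓝[>] 0) (𝓝 (∑ s, (P.constr z s + 0) * ν s + (P.cost z + 0) * α)) :=
      (Continuous.tendsto (by fun_prop) 0).mono_left nhdsWithin_le_nhds
    have := le_of_tendsto hlim (eventually_nhdsWithin_of_forall fun ε (hε : 0 < ε) =>
      (hsep z hz (fun s => P.constr z s + ε) (P.cost z + ε)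
        (fun s => by linarith) (by linarith)).le)
    simp only [add_zero] at this
    linarith
  have hdiv : P.lagrangian z (fun s => ν s / α) - v
      = ((P.cost z - v) * α + ∑ s, P.constr z s * ν s) / α := by
    have : ∀ s, ν s / α * P.constr z s = P.constr z s * ν s / α := fun s => by ring
    simp only [lagrangian, this, ← Finset.sum_div, add_div,
      mul_div_cancel_right₀ _ hαneg.ne]
    ring
  linarith [hdiv ▸ div_nonneg_of_nonpos hle hαneg.le]

/-- Strong duality for a given dual optimal `μ`: its dual value is at least the one of the multiplier
from `exists_multiplier`. -/
theorem IsDualOptimal.le_lagrangian {E : Type*} [AddCommGroup E] [Module ℝ E] {S : ℕ}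
    {P : ConstrainedProgram E S} {μ : Fin S → ℝ} (hμ : P.IsDualOptimal μ)
    (hcost : ConvexOn ℝ P.domain P.cost)
    (hconstr : ∀ s, ConvexOn ℝ P.domain (fun z => P.constr z s))
    (hSlater : ∃ z ∈ P.domain, ∀ s, P.constr z s < 0)
    {v : ℝ} (hv : ∀ w ∈ P.feasibleSet, v ≤ P.cost w) {z : E} (hz : z ∈ P.domain) :
    v ≤ P.lagrangian z μ := by
  obtain ⟨z₀, hz₀, hstrict⟩ := hSlater
  obtain ⟨ν, hν, hle⟩ := P.exists_multiplier hcost hconstr hz₀ hstrict hv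
  have h1 : (v : EReal) ≤ P.dualFunction ν :=
    le_iInf₂ fun w hw => EReal.coe_le_coe_iff.2 (hle w hw)
  exact EReal.coe_le_coe_iff.1 ((h1.trans (hμ.2 ν hν)).trans (iInf₂_le z hz))

end ConstrainedProgram

/-! ### The local problem -/

section Local

variable {m S : ℕ} {X : Set (EuclideanSpace ℝ (Fin m))} {f : EuclideanSpace ℝ (Fin m) → ℝ}
  {g : EuclideanSpace ℝ (Fin m) → Fin S → ℝ} {M : ℝ} {d : Fin S → ℝ}
  {x : EuclideanSpace ℝ (Fin m)} {ρ : ℝ} {μ : Fin S → ℝ}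

/-- Strong duality for the local problem, which satisfies Slater's condition since `ρ` may be taken
large. With `r = 0` this is the subgradient inequality for the local optimal cost. -/
theorem localProgram_le_lagrangian (hX : Convex ℝ X) (hf : ConvexOn ℝ Set.univ f)
    (hg : ∀ s, ConvexOn ℝ Set.univ (fun z => g z s))
    (h : (localProgram X f g M d).IsPrimalDualOptimal (x, ρ) μ)
    {x' : EuclideanSpace ℝ (Fin m)} (hx' : x' ∈ X) {r : ℝ} (hr : 0 ≤ r) :
    f x + M * ρ ≤ f x' + M * r + ∑ s, μ s * (g x' s + d s - r) := by
  have hdom : Convex ℝ (localProgram X f g M d).domain := by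
    change Convex ℝ (X ×ˢ Set.Ici (0 : ℝ))
    exact hX.prod (convex_Ici 0)
  have hcomp {φ : EuclideanSpace ℝ (Fin m) → ℝ} (hφ : ConvexOn ℝ Set.univ φ) :
      ConvexOn ℝ (localProgram X f g M d).domain (fun z => φ z.1) :=
    (hφ.comp_linearMap (LinearMap.fst ℝ _ ℝ)).subset (Set.subset_univ _) hdom
  have hsnd (c : ℝ) : ConvexOn ℝ (localProgram X f g M d).domain (fun z => c * z.2) :=
    (c • LinearMap.snd ℝ (EuclideanSpace ℝ (Fin m)) ℝ).convexOn hdom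
  refine h.2.le_lagrangian (P := localProgram X f g M d) ((hcomp hf).add (hsnd M)) (fun s => ?_)
    ⟨(x, 1 + ∑ s, |g x s + d s|), ⟨h.1.1.1.1, ?_⟩, fun s => ?_⟩ h.1.2 (z := (x', r)) ⟨hx', hr⟩
  · have := ((hcomp (hg s)).add_const (d s)).add (hsnd (-1))
    refine this.congr fun z _ => ?_
    simp [localProgram]; ring
  · change (0 : ℝ) ≤ 1 + ∑ s, |g x s + d s|
    positivity
  · have := Finset.single_le_sum (f := fun s => |g x s + d s|) (fun _ _ => abs_nonneg _)
      (Finset.mem_univ s)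
    change g x s + d s - (1 + ∑ s, |g x s + d s|) < 0
    linarith [le_abs_self (g x s + d s)]

/-- If `∑ s, μ s > M`, the Lagrangian would be unbounded below as `ρ → ∞`. -/
theorem localProgram_sum_multiplier_le (hX : Convex ℝ X) (hf : ConvexOn ℝ Set.univ f)
    (hg : ∀ s, ConvexOn ℝ Set.univ (fun z => g z s))
    (h : (localProgram X f g M d).IsPrimalDualOptimal (x, ρ) μ) : ∑ s, μ s ≤ M := by
  by_contra! hlt
  set c : ℝ := f x + ∑ s, μ s * (g x s + d s) - (f x + M * ρ) with hc
  have hkey (r : ℝ) (hr : 0 ≤ r) : 0 ≤ c + (M - ∑ s, μ s) * r := by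
    have := localProgram_le_lagrangian hX hf hg h h.1.1.1.1 hr
    simp only [mul_sub _ _ r, Finset.sum_sub_distrib, ← Finset.sum_mul] at this
    linarith
  have hpos : 0 < ∑ s, μ s - M := by linarith
  have := hkey ((|c| + 1) / (∑ s, μ s - M)) (by positivity)
  have h2 : (M - ∑ s, μ s) * ((|c| + 1) / (∑ s, μ s - M)) = -(|c| + 1) := by
    field_simp; ring
  linarith [le_abs_self c]

/-- The local optimal cost is `M`-Lipschitz in the perturbation `d` (for the sup norm): a change of `d`
by `δ` is compensated by increasing `ρ` by `δ`. -/
theorem localProgram_cost_le_add (h : (localProgram X f g M d).IsPrimalOptimal (x, ρ))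
    {d' : Fin S → ℝ} {x' : EuclideanSpace ℝ (Fin m)} {ρ' : ℝ}
    (h' : (localProgram X f g M d').IsPrimalOptimal (x', ρ'))
    {δ : ℝ} (hδ : 0 ≤ δ) (hd : ∀ s, d s ≤ d' s + δ) :
    f x + M * ρ ≤ f x' + M * ρ' + M * δ := by
  have hfeas : (x', ρ' + δ) ∈ (localProgram X f g M d).feasibleSet := by
    refine ⟨⟨h'.1.1.1, add_nonneg h'.1.1.2 hδ⟩, fun s => ?_⟩
    have h1 : g x' s + d' s - ρ' ≤ 0 := h'.1.2 s
    change g x' s + d s - (ρ' + δ) ≤ 0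
    linarith [hd s]
  have : f x + M * ρ ≤ f x' + M * (ρ' + δ) := h.2 _ hfeas
  linarith

end Local

/-! ### Net flows on a connected graph -/

namespace SimpleGraph

variable {V : Type*} [Fintype V] (G : SimpleGraph V) [DecidableRel G.Adj]

/-- The net flow `∑ j, (l i j - l j i)` out of vertex `i`, summed over the neighbors of `i`. The values
of `l` at nonadjacent pairs play no role, and `l i j`, `l j i` are independent variables. -/
def netFlow {A : Type*} [AddCommGroup A] (l : V → V → A) (i : V) : A :=
  ∑ j ∈ G.neighborFinset i, (l i j - l j i)

theorem sum_sum_neighborFinset_comm {A : Type*} [AddCommMonoid A] (h : V → V → A) :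
    ∑ i, ∑ j ∈ G.neighborFinset i, h i j = ∑ i, ∑ j ∈ G.neighborFinset i, h j i :=
  Finset.sum_comm' (by simp [G.adj_comm])

theorem sum_netFlow {A : Type*} [AddCommGroup A] (l : V → V → A) : ∑ i, G.netFlow l i = 0 := by
  simp only [netFlow, Finset.sum_sub_distrib]
  rw [G.sum_sum_neighborFinset_comm l, sub_self]

/-- Summation by parts: the adjoint of the net flow is the difference operator along edges. -/
theorem sum_mul_netFlow {R : Type*} [CommRing R] (p : V → R) (l : V → V → R) :
    ∑ i, p i * G.netFlow l i = ∑ i, ∑ j ∈ G.neighborFinset i, (p i - p j) * l i j := by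
  simp only [netFlow, Finset.mul_sum, mul_sub, sub_mul, Finset.sum_sub_distrib]
  rw [G.sum_sum_neighborFinset_comm fun i j => p i * l j i]

theorem netFlow_apply {ι A : Type*} [AddCommGroup A] (l : V → V → ι → A) (i : V) (s : ι) :
    G.netFlow l i s = G.netFlow (fun i j => l i j s) i := by
  simp [netFlow, Finset.sum_apply]

variable {G}

/-- An amount `c` can be sent from `a` to `b` along a walk. -/
theorem Reachable.exists_netFlow_eq {A : Type*} [AddCommGroup A] [DecidableEq V] {a b : V}
    (h : G.Reachable a b) (c : A) :
    ∃ l : V → V → A, ∀ i, G.netFlow l i = Pi.single (M := fun _ => A) a c i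
      - Pi.single (M := fun _ => A) b c i := by
  obtain ⟨w⟩ := h
  induction w with
  | nil => exact ⟨0, fun i => by simp [netFlow]⟩
  | @cons u v w huv _ ih =>
    obtain ⟨l, hl⟩ := ih
    refine ⟨fun i j => l i j + if i = u ∧ j = v then c else 0, fun i => ?_⟩
    have h1 : G.netFlow (fun i j => if i = u ∧ j = v then c else 0) i
        = Pi.single (M := fun _ => A) u c i - Pi.single (M := fun _ => A) v c i := by
      simp only [netFlow, Finset.sum_sub_distrib, ite_and, Pi.single_apply]
      by_cases hu : i = u
      · subst hu
        simp [huv, huv.ne]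
      · by_cases hv : i = v
        · subst hv
          simp [hu, huv.symm]
        · simp [hu, hv]
    have h2 : G.netFlow (fun i j => l i j + if i = u ∧ j = v then c else 0) i
        = G.netFlow l i + G.netFlow (fun i j => if i = u ∧ j = v then c else 0) i := by
      simp only [netFlow, ← Finset.sum_add_distrib]
      exact Finset.sum_congr rfl fun j _ => by abel
    rw [h2, h1, hl]
    abel

/-- On a connected graph every supply vector with zero sum is a net flow: all vertices send their
supply to a common root. -/
theorem Connected.exists_netFlow_eq {A : Type*} [AddCommGroup A] (hG : G.Connected)
    {w : V → A} (hw : ∑ i, w i = 0) : ∃ l : V → V → A, ∀ i, G.netFlow l i = w i := by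
  classical
  obtain ⟨r⟩ := hG.nonempty
  choose l hl using fun a => (hG.preconnected a r).exists_netFlow_eq (w a)
  refine ⟨fun i j => ∑ a, l a i j, fun i => ?_⟩
  have h : G.netFlow (fun i j => ∑ a, l a i j) i = ∑ a, G.netFlow (l a) i := by
    simp only [netFlow, ← Finset.sum_sub_distrib]
    exact Finset.sum_comm
  simp only [h, hl, Finset.sum_sub_distrib, Pi.single_apply, Finset.sum_ite_eq,
    Finset.mem_univ, if_true]
  split_ifs <;> simp [hw]

end SimpleGraph

/-! ### A descent criterion -/

/-- If a nonnegative `W` decreases by `2 γ a` up to an error `C γ ^ 2`, with `γ` square summable but not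
summable, and `a` increases by at most `K γ` per step, then `a` tends to zero. The first condition
makes `γ a` summable; then `a ^ 2` decreases up to the summable errors `2 K γ a + K ^ 2 γ ^ 2`, so it
converges, and a positive limit would make `γ` summable. -/
theorem tendsto_zero_of_descent {γ a W : ℕ → ℝ} {C K : ℝ} (hγ : ∀ t, 0 ≤ γ t)
    (hγsum : Tendsto (fun T => ∑ t ∈ Finset.range T, γ t) atTop atTop)
    (hγsq : Summable (fun t => γ t ^ 2)) (ha : ∀ t, 0 ≤ a t) (hW : ∀ t, 0 ≤ W t)
    (hdesc : ∀ t, W (t + 1) ≤ W t - 2 * γ t * a t + C * γ t ^ 2)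
    (hinc : ∀ t, a (t + 1) ≤ a t + K * γ t) : Tendsto a atTop (𝓝 0) := by
  have hsumm : Summable (fun t => γ t * a t) := by
    have hC : BddAbove (Set.range fun T => ∑ t ∈ Finset.range T, C * γ t ^ 2) :=
      (hγsq.mul_left C).hasSum.tendsto_sum_nat.bddAbove_range
    obtain ⟨B, hB⟩ := hC
    refine summable_of_sum_range_le (c := (W 0 + B) / 2)
      (fun t => mul_nonneg (hγ t) (ha t)) fun T => ?_
    have h : W T + 2 * ∑ t ∈ Finset.range T, γ t * a t
        ≤ W 0 + ∑ t ∈ Finset.range T, C * γ t ^ 2 := by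
      induction T with
      | zero => simp
      | succ T ih =>
        rw [Finset.sum_range_succ, Finset.sum_range_succ]
        linarith [hdesc T]
    linarith [hW T, hB ⟨T, rfl⟩]
  set e : ℕ → ℝ := fun t => 2 * K * (γ t * a t) + K ^ 2 * γ t ^ 2 with he
  have hsumm_e : Summable e := (hsumm.mul_left _).add (hγsq.mul_left _)
  have hlim_e := hsumm_e.hasSum.tendsto_sum_nat
  set w : ℕ → ℝ := fun t => a t ^ 2 - ∑ k ∈ Finset.range t, e k with hw
  have hanti : Antitone w := by
    refine antitone_nat_of_succ_le fun t => ?_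
    have h1 : a (t + 1) ^ 2 ≤ (a t + K * γ t) ^ 2 := pow_le_pow_left₀ (ha _) (hinc t) 2
    simp only [hw, Finset.sum_range_succ, he]
    linarith
  have hbdd : BddBelow (Set.range w) := by
    obtain ⟨B, hB⟩ := hlim_e.bddAbove_range
    refine ⟨-B, ?_⟩
    rintro _ ⟨t, rfl⟩
    have := hB ⟨t, rfl⟩
    simp only [hw] at this ⊢
    linarith [sq_nonneg (a t)]
  obtain ⟨ℓ, hℓ⟩ : ∃ ℓ, Tendsto (fun t => a t ^ 2) atTop (𝓝 ℓ) :=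
    ⟨_, ((tendsto_atTop_ciInf hanti hbdd).add hlim_e).congr fun t => by simp [hw]⟩
  have hℓ0 : ℓ = 0 := by
    by_contra hne
    have hpos : 0 < ℓ :=
      lt_of_le_of_ne (ge_of_tendsto' hℓ fun t => sq_nonneg _) (Ne.symm hne)
    have hev : ∀ᶠ t in atTop, √(ℓ / 2) ≤ a t := by
      filter_upwards [hℓ.eventually (lt_mem_nhds (half_lt_self hpos))] with t ht
      exact Real.sqrt_le_iff.2 ⟨ha t, ht.le⟩
    have hc : 0 < √(ℓ / 2) := Real.sqrt_pos.2 (half_pos hpos)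
    have hγs : Summable fun t => γ t * √(ℓ / 2) := by
      refine Summable.of_norm_bounded_eventually_nat hsumm ?_
      filter_upwards [hev] with t ht
      rw [Real.norm_of_nonneg (mul_nonneg (hγ t) hc.le)]
      exact mul_le_mul_of_nonneg_left ht (hγ t)
    exact (not_summable_iff_tendsto_nat_atTop_of_nonneg hγ).2 hγsum
      ((summable_mul_right_iff hc.ne').1 hγs)
  have := (Real.continuous_sqrt.tendsto _).comp hℓ
  rw [hℓ0, Real.sqrt_zero] at this
  exact this.congr fun t => Real.sqrt_sq (ha t)

/-! ### One step along the edges -/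

namespace SimpleGraph

variable {V : Type*} [Fintype V] (G : SimpleGraph V) [DecidableRel G.Adj]

/-- The squared Euclidean distance of two edge variables, over ordered pairs of adjacent vertices. -/
def flowDistSq {S : ℕ} (l l' : V → V → Fin S → ℝ) : ℝ :=
  ∑ i, ∑ j ∈ G.neighborFinset i, ∑ s, (l i j s - l' i j s) ^ 2

variable {G}

/-- The basic inequality of the subgradient method, for a step along the edge differences of `p`. -/
theorem flowDistSq_step_le {S : ℕ} {l l' lstar : V → V → Fin S → ℝ} {p : V → Fin S → ℝ} {c B : ℝ}
    (hstep : ∀ i j, G.Adj i j → l' i j = l i j - c • (p i - p j))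
    (hB : ∀ i j s, |p i s - p j s| ≤ B) :
    G.flowDistSq l' lstar ≤ G.flowDistSq l lstar
      - 2 * c * ∑ i, ∑ s, p i s * (G.netFlow l i s - G.netFlow lstar i s)
      + (∑ i, ∑ _j ∈ G.neighborFinset i, ∑ _s : Fin S, B ^ 2) * c ^ 2 := by
  have hflow : ∑ i, ∑ s, p i s * (G.netFlow l i s - G.netFlow lstar i s)
      = ∑ i, ∑ j ∈ G.neighborFinset i, ∑ s, (p i s - p j s) * (l i j s - lstar i j s) := by
    have h1 (s : Fin S) : ∑ i, p i s * (G.netFlow l i s - G.netFlow lstar i s)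
        = ∑ i, ∑ j ∈ G.neighborFinset i, (p i s - p j s) * (l i j s - lstar i j s) := by
      rw [← G.sum_mul_netFlow (fun i => p i s) fun i j => l i j s - lstar i j s]
      refine Finset.sum_congr rfl fun i _ => ?_
      rw [netFlow_apply, netFlow_apply]
      simp only [netFlow, ← Finset.sum_sub_distrib]
      congr 1
      exact Finset.sum_congr rfl fun j _ => by ring
    rw [Finset.sum_comm, Finset.sum_congr rfl fun s _ => h1 s, Finset.sum_comm]
    exact Finset.sum_congr rfl fun i _ => Finset.sum_comm
  rw [hflow]
  simp only [flowDistSq, Finset.mul_sum, Finset.sum_mul, ← Finset.sum_sub_distrib,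
    ← Finset.sum_add_distrib]
  refine Finset.sum_le_sum fun i _ => Finset.sum_le_sum fun j hj => Finset.sum_le_sum fun s _ => ?_
  rw [hstep i j (by simpa using hj)]
  have h2 : (p i s - p j s) ^ 2 ≤ B ^ 2 := sq_le_sq' (abs_le.1 (hB i j s)).1 (abs_le.1 (hB i j s)).2
  simp only [Pi.sub_apply, Pi.smul_apply, smul_eq_mul]
  nlinarith [mul_le_mul_of_nonneg_right h2 (sq_nonneg c)]

theorem netFlow_step_le {S : ℕ} {l l' : V → V → Fin S → ℝ} {p : V → Fin S → ℝ} {c B : ℝ}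
    (hc : 0 ≤ c) (hstep : ∀ i j, G.Adj i j → l' i j = l i j - c • (p i - p j))
    (hB : ∀ i j s, |p i s - p j s| ≤ B) (i : V) (s : Fin S) :
    G.netFlow l' i s ≤ G.netFlow l i s + G.degree i * (2 * B) * c := by
  have h : G.netFlow l' i s ≤ ∑ j ∈ G.neighborFinset i, ((l i j s - l j i s) + 2 * B * c) := by
    rw [netFlow_apply]
    refine Finset.sum_le_sum fun j hj => ?_
    beta_reduce
    have hij : G.Adj i j := by simpa using hj
    rw [hstep i j hij, hstep j i hij.symm]
    simp only [Pi.sub_apply, Pi.smul_apply, smul_eq_mul]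
    nlinarith [mul_le_mul_of_nonneg_left (neg_le_of_abs_le (hB i j s)) hc]
  rw [Finset.sum_add_distrib, Finset.sum_const, card_neighborFinset_eq_degree, nsmul_eq_mul] at h
  rw [netFlow_apply G l]
  refine h.trans (le_of_eq ?_)
  unfold netFlow
  ring

end SimpleGraph

/-! ### The coupled problem -/

theorem ConvexOn.continuous_of_univ {E : Type*} [NormedAddCommGroup E] [NormedSpace ℝ E]
    [FiniteDimensional ℝ E] {φ : E → ℝ} (hφ : ConvexOn ℝ Set.univ φ) : Continuous φ :=
  continuousOn_univ.1 (hφ.continuousOn isOpen_univ)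

section Coupled

variable {N S : ℕ} {n : Fin N → ℕ} {X : ∀ i, Set (EuclideanSpace ℝ (Fin (n i)))}
    {f : ∀ i, EuclideanSpace ℝ (Fin (n i)) → ℝ}
    {g : ∀ i, EuclideanSpace ℝ (Fin (n i)) → Fin S → ℝ}

theorem coupledProgram_convexOn_sum (hXconv : ∀ i, Convex ℝ (X i))
    {φ : ∀ i, EuclideanSpace ℝ (Fin (n i)) → ℝ} (hφ : ∀ i, ConvexOn ℝ Set.univ (φ i)) :
    ConvexOn ℝ (coupledProgram X f g).domain (fun z => ∑ i, φ i (z i)) := by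
  refine ⟨fun z hz w hw a b ha hb hab i => hXconv i (hz i) (hw i) ha hb hab,
    fun z _ w _ a b ha hb hab => ?_⟩
  simp only [Finset.smul_sum, ← Finset.sum_add_distrib]
  exact Finset.sum_le_sum fun i _ => (hφ i).2 trivial trivial ha hb hab

theorem coupledProgram_exists_isPrimalOptimal (hf : ∀ i, ConvexOn ℝ Set.univ (f i))
    (hg : ∀ i s, ConvexOn ℝ Set.univ (fun z => g i z s)) (hXcpt : ∀ i, IsCompact (X i))
    (hne : (coupledProgram X f g).feasibleSet.Nonempty) :
    ∃ z, (coupledProgram X f g).IsPrimalOptimal z := by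
  have hcpt : IsCompact (coupledProgram X f g).feasibleSet := by
    have h1 : IsCompact {z : ∀ i, EuclideanSpace ℝ (Fin (n i)) | ∀ i, z i ∈ X i} :=
      isCompact_pi_infinite hXcpt
    refine h1.inter_right ?_
    change IsClosed {z : ∀ i, EuclideanSpace ℝ (Fin (n i)) | ∀ s, ∑ i, g i (z i) s ≤ 0}
    simp only [Set.ofPred_forall]
    exact isClosed_iInter fun s => isClosed_le
      (continuous_finsetSum _ fun i _ => (hg i s).continuous_of_univ.comp (continuous_apply i))
      continuous_const
  have hcost : Continuous fun z : ∀ i, EuclideanSpace ℝ (Fin (n i)) => ∑ i, f i (z i) :=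
    continuous_finsetSum _ fun i _ => (hf i).continuous_of_univ.comp (continuous_apply i)
  obtain ⟨z, hz, hmin⟩ := hcpt.exists_isMinOn hne hcost.continuousOn
  exact ⟨z, hz, fun w hw => hmin hw⟩

/-- Relaxing the coupling constraint to `∑ i, g i (z i) ⪯ r 1` lowers the cost by at most
`(∑ s, μ s) * r`. -/
theorem coupledProgram_cost_le_of_relaxed {fStar : ℝ} {μ : Fin S → ℝ} (hμ : ∀ s, 0 ≤ μ s)
    {z : ∀ i, EuclideanSpace ℝ (Fin (n i))} (hle : fStar ≤ (coupledProgram X f g).lagrangian z μ)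
    {r : ℝ} (hr : ∀ s, ∑ i, g i (z i) s ≤ r) :
    fStar ≤ ∑ i, f i (z i) + (∑ s, μ s) * r := by
  refine hle.trans (add_le_add_right ?_ _)
  rw [Finset.sum_mul]
  exact Finset.sum_le_sum fun s _ => mul_le_mul_of_nonneg_left (hr s) (hμ s)

end Coupled

/-! ### Convergence of the algorithm -/

theorem theorem1 {N S : ℕ} {n : Fin N → ℕ}
    (G : SimpleGraph (Fin N)) [DecidableRel G.Adj] (hG : G.Connected)
    (X : ∀ i, Set (EuclideanSpace ℝ (Fin (n i))))
    (f : ∀ i, EuclideanSpace ℝ (Fin (n i)) → ℝ)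
    (g : ∀ i, EuclideanSpace ℝ (Fin (n i)) → Fin S → ℝ)
    (hf : ∀ i, ConvexOn ℝ Set.univ (f i))
    (hg : ∀ i s, ConvexOn ℝ Set.univ (fun z => g i z s))
    (hXne : ∀ i, (X i).Nonempty) (hXcpt : ∀ i, IsCompact (X i)) (hXconv : ∀ i, Convex ℝ (X i))
    (hSlater : ∃ xbar : ∀ i, EuclideanSpace ℝ (Fin (n i)),
      (∀ i, xbar i ∈ intrinsicInterior ℝ (X i)) ∧ ∀ s, ∑ i, g i (xbar i) s < 0)
    (γ : ℕ → ℝ) (hγ : ∀ t, 0 ≤ γ t)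
    (hγsum : Tendsto (fun T => ∑ t ∈ Finset.range T, γ t) atTop atTop)
    (hγsq : Summable (fun t => γ t ^ 2))
    (muStar : Fin S → ℝ) (hmuStar : (coupledProgram X f g).IsDualOptimal muStar)
    (M : ℝ) (hM : ∑ s, |muStar s| < M)
    (x : ℕ → ∀ i, EuclideanSpace ℝ (Fin (n i))) (ρ : ℕ → Fin N → ℝ)
    (μ : ℕ → Fin N → Fin S → ℝ) (lam : ℕ → Fin N → Fin N → Fin S → ℝ)
    (halg : IsGeneratedByAlgorithm G X f g M γ x ρ μ lam) :
    (∃ fStar : ℝ, (coupledProgram X f g).IsOptimalCost fStar ∧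
      Tendsto (fun t => ∑ i, (f i (x t i) + M * ρ t i)) atTop (𝓝 fStar)) ∧
    ∀ xlim : ∀ i, EuclideanSpace ℝ (Fin (n i)),
      MapClusterPt xlim atTop x → (coupledProgram X f g).IsPrimalOptimal xlim := by
  have hSlater' : ∃ z ∈ (coupledProgram X f g).domain, ∀ s, (coupledProgram X f g).constr z s < 0 :=
    hSlater.imp fun z hz => ⟨fun i => intrinsicInterior_subset (hz.1 i), hz.2⟩
  obtain ⟨xs, hxs⟩ := coupledProgram_exists_isPrimalOptimal hf hg hXcpt
    (hSlater'.imp fun z hz => ⟨hz.1, fun s => (hz.2 s).le⟩)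
  set fStar : ℝ := ∑ i, f i (xs i) with hfStar
  have hM' : ∑ s, muStar s < M := by
    simpa only [abs_of_nonneg (hmuStar.1 _)] using hM
  have hM0 : 0 < M := (Finset.sum_nonneg fun s _ => abs_nonneg (muStar s)).trans_lt hM
  have hrelax (z : ∀ i, EuclideanSpace ℝ (Fin (n i))) (hz : ∀ i, z i ∈ X i) (r : ℝ)
      (hr : ∀ s, ∑ i, g i (z i) s ≤ r) : fStar ≤ ∑ i, f i (z i) + (∑ s, muStar s) * r :=
    coupledProgram_cost_le_of_relaxed hmuStar.1
      (hmuStar.le_lagrangian (coupledProgram_convexOn_sum hXconv hf)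
        (fun s => coupledProgram_convexOn_sum hXconv fun i => hg i s) hSlater' hxs.2 hz) hr
  have hlocal (t i) : (localProgram (X i) (f i) (g i) M (G.netFlow (lam t) i)).IsPrimalDualOptimal
      (x (t + 1) i, ρ (t + 1) i) (μ (t + 1) i) := halg.local_step t i
  have hxX (t i) : x (t + 1) i ∈ X i := (hlocal t i).1.1.1.1
  have hρ (t i) : 0 ≤ ρ (t + 1) i := (hlocal t i).1.1.1.2
  have hμ0 (t i s) : 0 ≤ μ (t + 1) i s := (hlocal t i).2.1 s
  have hμM (t i s) : μ (t + 1) i s ≤ M :=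
    (Finset.single_le_sum (fun s _ => hμ0 t i s) (Finset.mem_univ s)).trans
      (localProgram_sum_multiplier_le (hXconv i) (hf i) (hg i) (hlocal t i))
  have hB (t i j s) : |μ (t + 1) i s - μ (t + 1) j s| ≤ M :=
    abs_le.2 ⟨by linarith [hμ0 t i s, hμM t j s], by linarith [hμ0 t j s, hμM t i s]⟩
  -- The net flows sum to zero, so they drop out of the sum of the local constraints.
  have hgρ (t s) : ∑ i, g i (x (t + 1) i) s ≤ ∑ i, ρ (t + 1) i := by
    have h1 : ∑ i, (g i (x (t + 1) i) s + G.netFlow (lam t) i s - ρ (t + 1) i) ≤ 0 :=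
      Finset.sum_nonpos fun i _ => (hlocal t i).1.1.2 s
    have h2 : ∑ i, G.netFlow (lam t) i s = 0 := by
      simpa using congrFun (G.sum_netFlow (lam t)) s
    rw [Finset.sum_sub_distrib, Finset.sum_add_distrib, h2] at h1
    linarith
  -- A flow `ls` for which `(xs i, 0)` is feasible for every local problem: each node gets an equal
  -- share of the (nonpositive) total constraint value.
  obtain ⟨ls, hls⟩ : ∃ ls : Fin N → Fin N → Fin S → ℝ, ∀ i, G.netFlow ls i
      = (N : ℝ)⁻¹ • ∑ j, g j (xs j) - g i (xs i) := by
    refine hG.exists_netFlow_eq ?_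
    have hN : (N : ℝ) ≠ 0 := by
      obtain ⟨i⟩ := hG.nonempty
      exact_mod_cast (Fin.pos i).ne'
    rw [Finset.sum_sub_distrib, Finset.sum_const, Finset.card_univ, Fintype.card_fin,
      ← Nat.cast_smul_eq_nsmul ℝ, smul_smul, mul_inv_cancel₀ hN, one_smul, sub_self]
  have hls' (i s) : g i (xs i) s + G.netFlow ls i s ≤ 0 := by
    have h1 : ∑ i, g i (xs i) s ≤ 0 := hxs.1.2 s
    have h2 := mul_nonpos_of_nonneg_of_nonpos (inv_nonneg.2 (Nat.cast_nonneg (α := ℝ) N)) h1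
    simpa [hls] using h2
  -- The optimality gap, shifted by one because the values at time `0` are arbitrary.
  set a : ℕ → ℝ := fun t => ∑ i, (f i (x (t + 1) i) + M * ρ (t + 1) i) - fStar with ha
  have hsub (t) : a t ≤ ∑ i, ∑ s, μ (t + 1) i s * (G.netFlow (lam t) i s - G.netFlow ls i s) := by
    simp only [ha, hfStar]
    rw [← Finset.sum_sub_distrib]
    refine Finset.sum_le_sum fun i _ => ?_
    have h1 := localProgram_le_lagrangian (hXconv i) (hf i) (hg i) (hlocal t i) (hxs.1.1 i) le_rfl
    have h2 : ∑ s, μ (t + 1) i s * (g i (xs i) s + G.netFlow (lam t) i s - 0)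
        ≤ ∑ s, μ (t + 1) i s * (G.netFlow (lam t) i s - G.netFlow ls i s) :=
      Finset.sum_le_sum fun s _ =>
        mul_le_mul_of_nonneg_left (by linarith [hls' i s]) (hμ0 t i s)
    linarith
  have hnonneg (t) : 0 ≤ a t := by
    have h1 := hrelax (x (t + 1)) (hxX t) _ (hgρ t)
    have h2 := mul_le_mul_of_nonneg_right hM'.le
      (Finset.sum_nonneg fun i (_ : i ∈ Finset.univ) => hρ t i)
    simp only [ha, Finset.sum_add_distrib, ← Finset.mul_sum]
    linarith
  have hlim : Tendsto a atTop (𝓝 0) := by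
    refine tendsto_zero_of_descent (W := fun t => G.flowDistSq (lam t) ls)
      (C := ∑ i, ∑ _j ∈ G.neighborFinset i, ∑ _s : Fin S, M ^ 2)
      (K := ∑ i, M * (G.degree i * (2 * M))) hγ hγsum hγsq hnonneg
      (fun t => by unfold SimpleGraph.flowDistSq; positivity) (fun t => ?_) (fun t => ?_)
    · have h1 := SimpleGraph.flowDistSq_step_le (lstar := ls) (halg.update t) (hB t)
      have h2 := mul_le_mul_of_nonneg_left (hsub t) (mul_nonneg zero_le_two (hγ t))
      linarith
    · have h1 : ∑ i, (f i (x (t + 1 + 1) i) + M * ρ (t + 1 + 1) i)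
          ≤ ∑ i, (f i (x (t + 1) i) + M * ρ (t + 1) i + M * (G.degree i * (2 * M) * γ t)) :=
        Finset.sum_le_sum fun i _ => localProgram_cost_le_add (hlocal (t + 1) i).1 (hlocal t i).1
          (mul_nonneg (by positivity) (hγ t))
          (SimpleGraph.netFlow_step_le (hγ t) (halg.update t) (hB t) i)
      rw [Finset.sum_add_distrib (g := fun i => M * (G.degree i * (2 * M) * γ t))] at h1
      simp only [← mul_assoc M _ (γ t), ← Finset.sum_mul] at h1
      simp only [ha]
      linarith
  have hcost : Tendsto (fun t => ∑ i, (f i (x t i) + M * ρ t i)) atTop (𝓝 fStar) := by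
    refine (tendsto_add_atTop_iff_nat 1).1 ?_
    simpa [ha] using hlim.add_const fStar
  refine ⟨⟨fStar, ⟨⟨xs, hxs.1, rfl⟩, ?_⟩, hcost⟩, fun xlim hxlim => ?_⟩
  · rintro _ ⟨w, hw, rfl⟩
    exact hxs.2 w hw
  obtain ⟨φ, hφ, hφlim⟩ := hxlim.tendsto_subseq
  have hev : ∀ᶠ k in atTop, 1 ≤ φ k := hφ.tendsto_atTop.eventually_ge_atTop 1
  have hcoord (i) : Tendsto (fun k => x (φ k) i) atTop (𝓝 (xlim i)) := tendsto_pi_nhds.1 hφlim i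
  have hflim : Tendsto (fun k => ∑ i, f i (x (φ k) i)) atTop (𝓝 (∑ i, f i (xlim i))) :=
    tendsto_finsetSum _ fun i _ => ((hf i).continuous_of_univ.tendsto _).comp (hcoord i)
  have hglim (s) : Tendsto (fun k => ∑ i, g i (x (φ k) i) s) atTop (𝓝 (∑ i, g i (xlim i) s)) :=
    tendsto_finsetSum _ fun i _ => ((hg i s).continuous_of_univ.tendsto _).comp (hcoord i)
  -- The limit of the total violation `∑ i, ρ i`, read off from the limit of the total cost.
  set r : ℝ := (fStar - ∑ i, f i (xlim i)) / M with hr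
  have hρlim : Tendsto (fun k => ∑ i, ρ (φ k) i) atTop (𝓝 r) := by
    refine (((hcost.comp hφ.tendsto_atTop).sub hflim).div_const M).congr fun k => ?_
    simp only [Function.comp_apply, Finset.sum_add_distrib, ← Finset.mul_sum]
    field_simp
    ring
  have hxlimX (i) : xlim i ∈ X i := by
    refine (hXcpt i).isClosed.mem_of_tendsto (hcoord i) ?_
    filter_upwards [hev] with k hk
    obtain ⟨t, ht⟩ := Nat.exists_eq_add_of_le' hk
    exact ht ▸ hxX t i
  have hr0 : 0 ≤ r := by
    refine ge_of_tendsto hρlim ?_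
    filter_upwards [hev] with k hk
    obtain ⟨t, ht⟩ := Nat.exists_eq_add_of_le' hk
    exact ht ▸ Finset.sum_nonneg fun i _ => hρ t i
  have hgr (s) : ∑ i, g i (xlim i) s ≤ r := by
    refine le_of_tendsto_of_tendsto (hglim s) hρlim ?_
    filter_upwards [hev] with k hk
    obtain ⟨t, ht⟩ := Nat.exists_eq_add_of_le' hk
    exact ht ▸ hgρ t s
  have hMr : M * r = fStar - ∑ i, f i (xlim i) := by rw [hr]; field_simp
  have hrz : r = 0 := by
    have h1 := hrelax xlim hxlimX r hgr
    refine le_antisymm ?_ hr0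
    by_contra! hpos
    linarith [mul_lt_mul_of_pos_right hM' hpos]
  refine ⟨⟨hxlimX, fun s => hrz ▸ hgr s⟩, fun w hw => ?_⟩
  have : ∑ i, f i (xlim i) = fStar := by rw [hrz] at hMr; linarith
  exact this.trans_le (hxs.2 w hw)
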